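/- For a finite group $G$, a positive integer $m$ and $u,g\in G$ put $G_m(u,g)=\{a\in G : a^m=(au)^m=g\}$. Call $G$ an $FSZ_m$ group if $|G_m(u,g)|=|G_m(u,g^n)|$ for all $u,g\in G$ and all positive integers $n$ coprime to $|G|$, and call $G$ an $FSZ$ group if it is $FSZ_m$ for every positive integer $m$. For a group $D$ and a prime $p$ let $D\wr_r\mathbb{Z}_p$ be the regular wreath product, that is, the semidirect product $D^p\rtimes\mathbb{Z}_p$ in which the cyclic group $\mathbb{Z}_p$ of order $p$ acts by cyclically permuting the factors of $D^p$. **Theorem.** Let $p$ be a prime. Then $(\mathbb{Z}_p\wr_r\mathbb{Z}_p)\wr_r\mathbb{Z}_p$ is $FSZ$. In particular, every Sylow $p$-subgroup of the symmetric group $S_{p^3}$ is $FSZ$. -/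

import Mathlib

namespace FSZGroups

/-- The set `G_m(u, g) = {a ∈ G : a ^ m = (a u) ^ m = g}`. -/
def powerSet {G : Type*} [Group G] (m : ℕ) (u g : G) : Set G :=
  {a : G | a ^ m = g ∧ (a * u) ^ m = g}

/-- A finite group `G` is `FSZ_m` if, for every positive integer `n` coprime to `|G|`,
`|G_m(u, g)| = |G_m(u, g ^ n)|` for all `u, g ∈ G`. -/
def IsFSZAt (G : Type*) [Group G] [Finite G] (m : ℕ) : Prop :=
  ∀ n : ℕ, 0 < n → Nat.Coprime n (Nat.card G) →
    ∀ u g : G, (powerSet m u g).ncard = (powerSet m u (g ^ n)).ncard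

/-- A finite group is `FSZ` if it is `FSZ_m` for every positive integer `m`. -/
def IsFSZ (G : Type*) [Group G] [Finite G] : Prop :=
  ∀ m : ℕ, 0 < m → IsFSZAt G m

end FSZGroups

/-! An inverse of `n` modulo the group order reduces each equality to one inequality, and roots of
order prime to `p` are unique, so only `m = p ^ j` matters. The inequality comes from an injection
`a ↦ h * a` with `h` in the base group, chosen to correct the powers of `a` and `a * u` at once. If
`g` is a diagonal monomial matrix, then on its nontrivial entries `a` and `a * u` have only cycles
of length `p ^ j`; Hall's theorem gives a common transversal, and `h` puts `n - 1` extra powers of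
the entries of `g` there (`ncard_powerSet_le`). If `g` is not diagonal, `j ≥ 2` leaves no roots, and
for `j = 1` every root permutes the factors cyclically, so one correction in a single coordinate
suffices (`ncard_powerSet_le_of_right_ne_one`). -/

namespace FSZGroups

/-! ### Common transversals of cycles -/

section Transversal

/-- Two partitions of a finite set into blocks of the same size have a common transversal. -/
theorem exists_common_transversal {X I J : Type*} [Fintype X] [Fintype I] [Fintype J]
    [DecidableEq I] [DecidableEq J] (α : X → I) (β : X → J) {m : ℕ} (hm : 0 < m)
    (hα : ∀ i, (Finset.univ.filter fun x => α x = i).card = m)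
    (hβ : ∀ j, (Finset.univ.filter fun x => β x = j).card = m) :
    ∃ T : Set X, (∀ i, ∃! x, x ∈ T ∧ α x = i) ∧ ∀ j, ∃! x, x ∈ T ∧ β x = j := by
  classical
  have hcardα : Fintype.card X = Fintype.card I * m := by
    rw [← Finset.card_univ, Finset.card_eq_sum_card_fiberwise (f := α) (t := Finset.univ)
      (fun _ _ => Finset.mem_coe.2 (Finset.mem_univ _))]
    simp [hα]
  have hcardβ : Fintype.card X = Fintype.card J * m := by
    rw [← Finset.card_univ, Finset.card_eq_sum_card_fiberwise (f := β) (t := Finset.univ)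
      (fun _ _ => Finset.mem_coe.2 (Finset.mem_univ _))]
    simp [hβ]
  have hIJ : Fintype.card I = Fintype.card J :=
    Nat.eq_of_mul_eq_mul_right hm (hcardα.symm.trans hcardβ)
  let t : I → Finset J := fun i => (Finset.univ.filter fun x => α x = i).image β
  -- Hall's condition by counting points: the `α`-blocks in `s` are contained in the `β`-blocks they
  -- meet, and all blocks have size `m`.
  have hall : ∀ s : Finset I, s.card ≤ (s.biUnion t).card := by
    intro s
    have h1 : (Finset.univ.filter fun x => α x ∈ s).card = s.card * m := by
      rw [Finset.card_eq_sum_card_fiberwise (f := α) (t := s) (fun x hx => by simpa using hx)]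
      rw [Finset.sum_congr rfl (g := fun _ => m), Finset.sum_const, smul_eq_mul]
      intro i hi
      rw [← hα i, Finset.filter_filter]
      congr 1
      ext x
      simp only [Finset.mem_filter, Finset.mem_univ, true_and]
      exact ⟨fun h => h.2, fun h => ⟨h ▸ hi, h⟩⟩
    have h2 : (Finset.univ.filter fun x => β x ∈ s.biUnion t).card = (s.biUnion t).card * m := by
      rw [Finset.card_eq_sum_card_fiberwise (f := β) (t := s.biUnion t)
        (fun x hx => by simpa using hx)]
      rw [Finset.sum_congr rfl (g := fun _ => m), Finset.sum_const, smul_eq_mul]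
      intro i hi
      rw [← hβ i, Finset.filter_filter]
      congr 1
      ext x
      simp only [Finset.mem_filter, Finset.mem_univ, true_and]
      exact ⟨fun h => h.2, fun h => ⟨h ▸ hi, h⟩⟩
    refine Nat.le_of_mul_le_mul_right ?_ hm
    rw [← h1, ← h2]
    refine Finset.card_le_card fun x hx => ?_
    simp only [Finset.mem_filter, Finset.mem_univ, true_and] at hx ⊢
    exact Finset.mem_biUnion.2 ⟨α x, hx, Finset.mem_image.2 ⟨x, by simp, rfl⟩⟩
  obtain ⟨f, hf, hft⟩ := (Finset.all_card_le_biUnion_card_iff_exists_injective t).1 hall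
  have hfb : Function.Bijective f := (Fintype.bijective_iff_injective_and_card f).2 ⟨hf, hIJ⟩
  have hx : ∀ i, ∃ x, α x = i ∧ β x = f i := fun i => by
    obtain ⟨x, hx, hx'⟩ := Finset.mem_image.1 (hft i)
    exact ⟨x, (Finset.mem_filter.1 hx).2, hx'⟩
  choose s hs1 hs2 using hx
  refine ⟨Set.range s, fun i => ⟨s i, ⟨⟨i, rfl⟩, hs1 i⟩, ?_⟩, fun j => ?_⟩
  · rintro _ ⟨⟨i', rfl⟩, h⟩
    rw [← h, hs1]
  · obtain ⟨i, rfl⟩ := hfb.2 j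
    refine ⟨s i, ⟨⟨i, rfl⟩, hs2 i⟩, ?_⟩
    rintro _ ⟨⟨i', rfl⟩, h⟩
    rw [hf ((hs2 i').symm.trans h)]

theorem sameCycle_iff_exists_pow_lt {X : Type*} {π : Equiv.Perm X} {m : ℕ} (hm : 0 < m)
    (hπ : π ^ m = 1) {x y : X} : π.SameCycle x y ↔ ∃ i < m, (π ^ i) x = y := by
  refine ⟨?_, fun ⟨i, _, hi⟩ => ⟨i, by simpa using hi⟩⟩
  rintro ⟨z, hz⟩
  have hm' : (m : ℤ) ≠ 0 := by exact_mod_cast hm.ne'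
  have h0 := Int.emod_nonneg z hm'
  have h1 := Int.emod_lt_of_pos z (by exact_mod_cast hm : (0 : ℤ) < m)
  refine ⟨(z % m).toNat, by omega, ?_⟩
  rw [← hz, ← zpow_natCast, Int.toNat_of_nonneg h0]
  conv_rhs => rw [← Int.emod_add_mul_ediv z m, zpow_add, zpow_mul, zpow_natCast, hπ, one_zpow,
    mul_one]

theorem injOn_pow_apply {X : Type*} {π : Equiv.Perm X} {m : ℕ}
    (hfree : ∀ i, 0 < i → i < m → ∀ x, (π ^ i) x ≠ x) {x : X} {i j : ℕ} (hi : i < m) (hj : j < m)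
    (h : (π ^ i) x = (π ^ j) x) : i = j := by
  wlog hij : i ≤ j generalizing i j
  · exact (this hj hi h.symm (by omega)).symm
  by_contra hne
  refine hfree (j - i) (by omega) (by omega) x ((π ^ i).injective ?_)
  rw [h, ← Equiv.Perm.mul_apply, ← pow_add, Nat.add_sub_cancel' hij]

theorem card_filter_mk_eq {X : Type*} [Fintype X] {π : Equiv.Perm X} {m : ℕ} (hm : 0 < m)
    (hπ : π ^ m = 1) (hfree : ∀ i, 0 < i → i < m → ∀ x, (π ^ i) x ≠ x)
    [DecidableEq (Quotient (Equiv.Perm.SameCycle.setoid π))]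
    (c : Quotient (Equiv.Perm.SameCycle.setoid π)) :
    (Finset.univ.filter fun x => Quotient.mk _ x = c).card = m := by
  classical
  obtain ⟨x, rfl⟩ := Quotient.exists_rep c
  have : (Finset.univ.filter fun y => Quotient.mk (Equiv.Perm.SameCycle.setoid π) y =
      Quotient.mk _ x) = (Finset.range m).image fun i => (π ^ i) x := by
    ext y
    simp only [Finset.mem_filter, Finset.mem_univ, true_and, Finset.mem_image, Finset.mem_range]
    rw [eq_comm, Quotient.eq]
    exact sameCycle_iff_exists_pow_lt hm hπ
  rw [this, Finset.card_image_of_injOn, Finset.card_range]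
  intro i hi j hj h
  exact injOn_pow_apply hfree (by simpa using hi) (by simpa using hj) h

/-- Two permutations of a finite set, all of whose cycles have length `m`, have a common
transversal of their cycles. -/
theorem exists_common_cycle_transversal {X : Type*} [Finite X] {π σ : Equiv.Perm X} {m : ℕ}
    (hm : 0 < m) (hπ : π ^ m = 1) (hπfree : ∀ i, 0 < i → i < m → ∀ x, (π ^ i) x ≠ x)
    (hσ : σ ^ m = 1) (hσfree : ∀ i, 0 < i → i < m → ∀ x, (σ ^ i) x ≠ x) :
    ∃ T : Set X, (∀ x, ∃! i, i < m ∧ (π ^ i) x ∈ T) ∧ ∀ x, ∃! i, i < m ∧ (σ ^ i) x ∈ T := by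
  classical
  have := Fintype.ofFinite X
  obtain ⟨T, h1, h2⟩ := exists_common_transversal
    (Quotient.mk (Equiv.Perm.SameCycle.setoid π)) (Quotient.mk (Equiv.Perm.SameCycle.setoid σ)) hm
    (card_filter_mk_eq hm hπ hπfree) (card_filter_mk_eq hm hσ hσfree)
  have key : ∀ τ : Equiv.Perm X, τ ^ m = 1 → (∀ i, 0 < i → i < m → ∀ x, (τ ^ i) x ≠ x) →
      (∀ c, ∃! x, x ∈ T ∧ Quotient.mk (Equiv.Perm.SameCycle.setoid τ) x = c) →
      ∀ x, ∃! i, i < m ∧ (τ ^ i) x ∈ T := by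
    intro τ hτ hτfree h x
    obtain ⟨y, ⟨hyT, hyx⟩, huniq⟩ := h (Quotient.mk _ x)
    obtain ⟨i, him, rfl⟩ := (sameCycle_iff_exists_pow_lt hm hτ).1 (Quotient.exact hyx.symm)
    refine ⟨i, ⟨him, hyT⟩, fun j ⟨hj, hjT⟩ => ?_⟩
    refine injOn_pow_apply hτfree hj him (huniq _ ⟨hjT, ?_⟩)
    exact (Quotient.sound ((sameCycle_iff_exists_pow_lt hm hτ).2 ⟨j, hj, rfl⟩)).symm
  exact ⟨T, key π hπ hπfree h1, key σ hσ hσfree h2⟩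

end Transversal

/-! ### Monomial actions and diagonal `g` -/

section Monomial

/-- A faithful action of `G` on `Ω` by monomial matrices with entries in `C`, such that `G`
contains all diagonal matrices. -/
structure MonomialAction (C G Ω : Type*) [CommGroup C] [Group G] [MulAction G Ω] where
  /-- The nonzero entry of a monomial matrix in the column `x`. -/
  entry : G → Ω → C
  entry_mul : ∀ g h x, entry (g * h) x = entry g (h • x) * entry h x
  /-- The diagonal matrices. -/
  diag : (Ω → C) → G
  diag_smul : ∀ (f : Ω → C) (x : Ω), diag f • x = x
  entry_diag : ∀ f x, entry (diag f) x = f x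
  ext : ∀ g h : G, (∀ x : Ω, g • x = h • x) → (∀ x, entry g x = entry h x) → g = h

namespace MonomialAction

/-- A commutative group as a group of monomial matrices of size one. -/
def punit (C : Type*) [CommGroup C] : MonomialAction C C Unit where
  entry g _ := g
  entry_mul _ _ _ := rfl
  diag f := f PUnit.unit
  diag_smul _ _ := rfl
  entry_diag _ _ := rfl
  ext _ _ _ h := h PUnit.unit

variable {C G Ω : Type*} [CommGroup C] [Group G] [MulAction G Ω]

/-- The monomial action of a regular wreath product. -/
def wreath [Nonempty Ω] (M : MonomialAction C G Ω) (Q : Type*) [Group Q] :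
    MonomialAction C (G ≀ᵣ Q) (Ω × Q) where
  entry a x := M.entry (a.left (a.right * x.2)) x.1
  entry_mul a b x := by
    simp [M.entry_mul, mul_assoc]
  diag f := ⟨fun q => M.diag fun x => f (x, q), 1⟩
  diag_smul f x := by
    ext <;> simp [M.diag_smul]
  entry_diag f x := by simp [M.entry_diag]
  ext a b h1 h2 := by
    obtain ⟨x₀⟩ := ‹Nonempty Ω›
    have hr : a.right = b.right := by simpa using congrArg Prod.snd (h1 (x₀, 1))
    ext q
    · refine M.ext _ _ (fun x => ?_) fun x => ?_
      · simpa [hr] using congrArg Prod.fst (h1 (x, b.right⁻¹ * q))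
      · simpa [hr] using h2 (x, b.right⁻¹ * q)
    · exact hr

variable (M : MonomialAction C G Ω)

theorem entry_one (x : Ω) : M.entry 1 x = 1 := by
  simpa using M.entry_mul 1 1 x

theorem entry_pow_of_smul_eq {g : G} {x : Ω} (h : g • x = x) (n : ℕ) :
    M.entry (g ^ n) x = M.entry g x ^ n := by
  induction n with
  | zero => simp [M.entry_one]
  | succ n ih => rw [pow_succ, M.entry_mul, h, ih, pow_succ]

theorem diag_mul_pow_smul (h : Ω → C) (a : G) (n : ℕ) (x : Ω) :
    (M.diag h * a) ^ n • x = a ^ n • x := by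
  induction n with
  | zero => simp
  | succ n ih => rw [pow_succ', mul_smul, ih, mul_smul, M.diag_smul, pow_succ', mul_smul]

theorem entry_diag_mul_pow (h : Ω → C) (a : G) (n : ℕ) (x : Ω) :
    M.entry ((M.diag h * a) ^ n) x =
      (∏ i ∈ Finset.range n, h (a ^ (i + 1) • x)) * M.entry (a ^ n) x := by
  induction n with
  | zero => simp
  | succ n ih =>
    rw [pow_succ', M.entry_mul, ih, M.diag_mul_pow_smul, M.entry_mul, M.entry_diag,
      Finset.prod_range_succ, pow_succ' a n, M.entry_mul, mul_smul]
    simp only [mul_assoc, mul_left_comm, mul_comm]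

/-- A root `a` commutes with `g`; compare the entries of `g * a` and `a * g` and cancel in `C`. -/
theorem entry_smul_of_pow_eq {g a : G} {m : ℕ} (ha : a ^ m = g) (hg : ∀ x : Ω, g • x = x)
    (x : Ω) : M.entry g (a • x) = M.entry g x := by
  have h : g * a = a * g := by rw [← ha, ← pow_succ, pow_succ']
  have := congrArg (fun b => M.entry b x) h
  simp only [M.entry_mul, hg] at this
  rwa [mul_comm, mul_right_inj] at this

theorem entry_pow_smul_of_pow_eq {g a : G} {m : ℕ} (ha : a ^ m = g) (hg : ∀ x : Ω, g • x = x)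
    (n : ℕ) (x : Ω) : M.entry g (a ^ n • x) = M.entry g x := by
  induction n with
  | zero => simp
  | succ n ih => rw [pow_succ', mul_smul, M.entry_smul_of_pow_eq ha hg, ih]

/-- Each nontrivial cycle meets `T` once, so the correction contributes `n - 1` copies of the entry
of `g`, which is constant along the cycle; `a ^ m` supplies the last copy. -/
theorem diag_mul_pow_eq_pow {g a : G} {m n : ℕ} (hn : 0 < n) (ha : a ^ m = g)
    (hg : ∀ x : Ω, g • x = x) {T : Set Ω}
    (hT : ∀ x, M.entry g x ≠ 1 → ∃! i, i < m ∧ a ^ i • x ∈ T) [DecidablePred (· ∈ T)] :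
    (M.diag (fun x => if x ∈ T then M.entry g x ^ (n - 1) else 1) * a) ^ m = g ^ n := by
  have hgn : ∀ x : Ω, g ^ n • x = x := fun x =>
    MulAction.mem_stabilizer_iff.1 (Subgroup.pow_mem _ (MulAction.mem_stabilizer_iff.2 (hg x)) n)
  refine M.ext _ _ (fun x => ?_) fun x => ?_
  · rw [M.diag_mul_pow_smul, ha, hg, hgn]
  · rw [M.entry_diag_mul_pow, ha, M.entry_pow_of_smul_eq (hg x)]
    have : ∏ i ∈ Finset.range m, (fun x => if x ∈ T then M.entry g x ^ (n - 1) else 1)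
        (a ^ (i + 1) • x) = M.entry g x ^ (n - 1) := by
      simp only [M.entry_pow_smul_of_pow_eq ha hg]
      by_cases hx : M.entry g x = 1
      · simp [hx]
      -- The product runs over exponents `1` to `m`, hence the orbit is started at `a • x`.
      obtain ⟨i, ⟨him, hiT⟩, huniq⟩ := hT (a • x) (by rwa [M.entry_smul_of_pow_eq ha hg])
      simp only [← mul_smul, ← pow_succ] at hiT huniq
      rw [Finset.prod_eq_single i, if_pos hiT]
      · intro j hj hji
        exact if_neg fun h => hji (huniq j ⟨Finset.mem_range.1 hj, h⟩)
      · exact fun h => absurd (Finset.mem_range.2 him) h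
    rw [this, ← pow_succ, Nat.sub_add_cancel hn]

/-- A shorter cycle would have length dividing `p ^ k` with `k < j`, making the entry of `g` at `x`
a `p`-th power in `C`, hence trivial. -/
theorem pow_smul_ne {p : ℕ} (hp : p.Prime) (hC : ∀ c : C, c ^ p = 1) {g a : G} {j : ℕ}
    (ha : a ^ p ^ j = g) (hg : ∀ x : Ω, g • x = x) {x : Ω} (hx : M.entry g x ≠ 1) {i : ℕ}
    (hi0 : 0 < i) (hi : i < p ^ j) : a ^ i • x ≠ x := by
  intro h
  have h1 : Function.IsPeriodicPt (a • ·) i x := by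
    rw [Function.IsPeriodicPt, Function.IsFixedPt, smul_iterate]; exact h
  have h2 : Function.IsPeriodicPt (a • ·) (p ^ j) x := by
    rw [Function.IsPeriodicPt, Function.IsFixedPt, smul_iterate]; simpa [ha] using hg x
  have h3 := h1.gcd h2
  obtain ⟨k, hk, hk'⟩ := (Nat.dvd_prime_pow hp).1 (Nat.gcd_dvd_right i (p ^ j))
  have hkj : k < j := by
    refine lt_of_le_of_ne hk fun hkj => ?_
    have := Nat.le_of_dvd hi0 (Nat.gcd_dvd_left i (p ^ j))
    rw [hk', hkj] at this
    omega
  rw [hk', Function.IsPeriodicPt, Function.IsFixedPt, smul_iterate] at h3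
  have h4 : g = (a ^ p ^ k) ^ p ^ (j - k) := by
    rw [← ha, ← pow_mul, ← pow_add, Nat.add_sub_cancel' hk]
  apply hx
  rw [h4, M.entry_pow_of_smul_eq h3, show j - k = (j - k - 1) + 1 by omega, pow_succ', pow_mul, hC,
    one_pow]

/-- The permutation of the support of the entries of `g` induced by a root `a` of `g`. -/
def supportPerm {g a : G} {m : ℕ} (ha : a ^ m = g) (hg : ∀ x : Ω, g • x = x) :
    Equiv.Perm {x : Ω // M.entry g x ≠ 1} :=
  (MulAction.toPerm a).subtypePerm fun x => by
    rw [MulAction.toPerm_apply, M.entry_smul_of_pow_eq ha hg]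

theorem coe_supportPerm_pow {g a : G} {m : ℕ} (ha : a ^ m = g) (hg : ∀ x : Ω, g • x = x) (i : ℕ)
    (x : {x : Ω // M.entry g x ≠ 1}) :
    (((M.supportPerm ha hg) ^ i) x : Ω) = a ^ i • (x : Ω) := by
  induction i with
  | zero => simp
  | succ i ih =>
    rw [pow_succ', pow_succ', Equiv.Perm.mul_apply, mul_smul, ← ih]
    rfl

theorem exists_transversal [Finite Ω] {p : ℕ} (hp : p.Prime) (hC : ∀ c : C, c ^ p = 1)
    {g a b : G} {j : ℕ} (ha : a ^ p ^ j = g) (hb : b ^ p ^ j = g) (hg : ∀ x : Ω, g • x = x) :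
    ∃ T : Set Ω, (∀ x, M.entry g x ≠ 1 → ∃! i, i < p ^ j ∧ a ^ i • x ∈ T) ∧
      ∀ x, M.entry g x ≠ 1 → ∃! i, i < p ^ j ∧ b ^ i • x ∈ T := by
  have one : ∀ {c : G} (hc : c ^ p ^ j = g), (M.supportPerm hc hg) ^ p ^ j = 1 := fun hc => by
    ext x
    rw [M.coe_supportPerm_pow, hc, hg, Equiv.Perm.one_apply]
  have free : ∀ {c : G} (hc : c ^ p ^ j = g), ∀ i, 0 < i → i < p ^ j → ∀ x,
      ((M.supportPerm hc hg) ^ i) x ≠ x := fun hc i h0 hi x h => by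
    refine M.pow_smul_ne hp hC hc hg x.2 h0 hi ?_
    rw [← M.coe_supportPerm_pow hc hg, h]
  obtain ⟨T, h1, h2⟩ := exists_common_cycle_transversal (pow_pos hp.pos j) (one ha) (free ha)
    (one hb) (free hb)
  have key : ∀ {c : G} (hc : c ^ p ^ j = g) (x : {x : Ω // M.entry g x ≠ 1}) (i : ℕ),
      ((M.supportPerm hc hg) ^ i) x ∈ T ↔ c ^ i • (x : Ω) ∈ Subtype.val '' T := fun hc x i => by
    rw [← M.coe_supportPerm_pow hc hg, Subtype.val_injective.mem_set_image]
  refine ⟨Subtype.val '' T, fun x hx => ?_, fun x hx => ?_⟩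
  · simpa only [key] using h1 ⟨x, hx⟩
  · simpa only [key] using h2 ⟨x, hx⟩

/-- If `g` is diagonal, then raising `g` to a power does not decrease the number of elements of
`powerSet (p ^ j) u g`. -/
theorem ncard_powerSet_le (M : MonomialAction C G Ω) [Finite G] [Finite Ω] {p : ℕ} (hp : p.Prime)
    (hC : ∀ c : C, c ^ p = 1) (j : ℕ) (u : G) {g : G} (hg : ∀ x : Ω, g • x = x) {n : ℕ} (hn : 0 < n) :
    (powerSet (p ^ j) u g).ncard ≤ (powerSet (p ^ j) u (g ^ n)).ncard := by
  classical
  -- The correction depends only on the permutation of `a`, which `M.diag h * a` still determines;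
  -- this gives injectivity below.
  have key : ∀ π : Equiv.Perm Ω, ∃ h : Ω → C, ∀ a ∈ powerSet (p ^ j) u g,
      MulAction.toPerm a = π → M.diag h * a ∈ powerSet (p ^ j) u (g ^ n) := by
    intro π
    by_cases hex : ∃ a ∈ powerSet (p ^ j) u g, MulAction.toPerm a = π
    · obtain ⟨a, ⟨ha, hau⟩, rfl⟩ := hex
      obtain ⟨T, h1, h2⟩ := M.exists_transversal hp hC ha hau hg
      refine ⟨fun x => if x ∈ T then M.entry g x ^ (n - 1) else 1, fun b hb hba => ?_⟩
      have hsmul : MulAction.toPermHom G Ω b = MulAction.toPermHom G Ω a := hba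
      have e1 : ∀ i x, b ^ i • x = a ^ i • x := fun i (x : Ω) => by
        change MulAction.toPermHom G Ω (b ^ i) x = MulAction.toPermHom G Ω (a ^ i) x
        rw [map_pow, map_pow, hsmul]
      have e2 : ∀ i x, (b * u) ^ i • x = (a * u) ^ i • x := fun i (x : Ω) => by
        change MulAction.toPermHom G Ω ((b * u) ^ i) x = MulAction.toPermHom G Ω ((a * u) ^ i) x
        rw [map_pow, map_pow, map_mul, map_mul, hsmul]
      refine ⟨M.diag_mul_pow_eq_pow hn hb.1 hg (by simpa only [e1] using h1), ?_⟩
      rw [mul_assoc]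
      exact M.diag_mul_pow_eq_pow hn hb.2 hg (by simpa only [e2] using h2)
    · exact ⟨1, fun a ha h => absurd ⟨a, ha, h⟩ hex⟩
  choose h hh using key
  refine Set.ncard_le_ncard_of_injOn (fun a => M.diag (h (MulAction.toPerm a)) * a)
    (fun a ha => hh _ a ha rfl) (fun a _ b _ hab => ?_) (Set.toFinite _)
  have hperm : (MulAction.toPerm a : Equiv.Perm Ω) = MulAction.toPerm b := by
    ext x
    have := congrArg (· • x) hab
    simpa [mul_smul, M.diag_smul] using this
  simpa [hperm] using hab

end MonomialAction

end Monomial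

/-! ### Roots outside the base group -/

section Wreath

theorem list_prod_map_mulSingle {ι D : Type*} [DecidableEq ι] [Group D] (f : ι → D) (l : List ι)
    (hl : l.Nodup) (q : ι) :
    (l.map fun r => Pi.mulSingle r (f r)).prod q = if q ∈ l then f q else 1 := by
  induction l with
  | nil => simp
  | cons r l ih =>
    rw [List.nodup_cons] at hl
    rw [List.map_cons, List.prod_cons, Pi.mul_apply, ih hl.2]
    by_cases hq : q = r
    · subst hq
      simp [hl.1]
    · simp [hq]

variable {D Q : Type*} [Group D] [Group Q]

/-- The embedding of the base group of a regular wreath product. -/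
def baseHom (D Q : Type*) [Group D] [Group Q] : (Q → D) →* D ≀ᵣ Q where
  toFun f := ⟨f, 1⟩
  map_one' := rfl
  map_mul' f f' := by ext <;> simp

theorem conj_baseHom_mulSingle [DecidableEq Q] {b : D ≀ᵣ Q} {f : Q → D}
    (hb : Commute b (baseHom D Q f)) (k : ℕ) :
    b * baseHom D Q (Pi.mulSingle 1 (f 1 ^ k)) =
      baseHom D Q (Pi.mulSingle b.right (f b.right ^ k)) * b := by
  have h : b.left b.right * f 1 = f b.right * b.left b.right := by
    simpa [baseHom] using congrFun (congrArg RegularWreathProduct.left hb.eq) b.right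
  have hk : b.left b.right * f 1 ^ k = f b.right ^ k * b.left b.right :=
    SemiconjBy.pow_right (show SemiconjBy _ _ _ from h) k
  ext q
  · by_cases hq : q = b.right
    · subst hq
      simpa [baseHom] using hk
    · have : b.right⁻¹ * q ≠ 1 := fun h => hq (inv_mul_eq_one.1 h).symm
      simp [baseHom, Pi.mulSingle_eq_of_ne hq, Pi.mulSingle_eq_of_ne this]
  · simp [baseHom]

/-- Moving each `a` to the right carries the correction at coordinate `1` to the successive powers
of `a.right`. -/
theorem baseHom_mul_pow [DecidableEq Q] {a : D ≀ᵣ Q} {f : Q → D}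
    (ha : Commute a (baseHom D Q f)) (k n : ℕ) :
    (baseHom D Q (Pi.mulSingle 1 (f 1 ^ k)) * a) ^ n =
      baseHom D Q ((List.range n).map fun i =>
        Pi.mulSingle (a.right ^ i) (f (a.right ^ i) ^ k)).prod * a ^ n := by
  induction n with
  | zero => simp
  | succ n ih =>
    have h := conj_baseHom_mulSingle (ha.pow_left n) k
    have hr : (a ^ n).right = a.right ^ n := map_pow RegularWreathProduct.rightHom a n
    rw [hr] at h
    rw [pow_succ, ih, List.range_succ, List.map_append, List.prod_append, map_mul, pow_succ]
    simp only [List.map_cons, List.map_nil, List.prod_singleton, mul_assoc]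
    rw [← mul_assoc (a ^ n), h, mul_assoc]

/-- Raising `g` to a power does not decrease the number of elements of `powerSet p u g`, if no
`p`-th root of `g` lies in the base group. -/
theorem ncard_powerSet_le_of_right_ne_one [Finite D] {p : ℕ} (hp : p.Prime) (hQ : Nat.card Q = p)
    (u : D ≀ᵣ Q) {g : D ≀ᵣ Q} (hg : ∀ b : D ≀ᵣ Q, b ^ p = g → b.right ≠ 1) {n : ℕ} (hn : 0 < n) :
    (powerSet p u g).ncard ≤ (powerSet p u (g ^ n)).ncard := by
  classical
  have : Finite Q := Nat.finite_of_card_ne_zero (hQ ▸ hp.ne_zero)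
  have key : ∀ b : D ≀ᵣ Q, b ^ p = g →
      (baseHom D Q (Pi.mulSingle 1 (g.left 1 ^ (n - 1))) * b) ^ p = g ^ n := by
    intro b hb
    have hgr : g = baseHom D Q g.left := by
      ext q
      · rfl
      · have : g.right = b.right ^ p := by
          rw [← hb]; exact map_pow RegularWreathProduct.rightHom b p
        rw [this, ← hQ, pow_card_eq_one']
        rfl
    have hcomm : Commute b (baseHom D Q g.left) := by
      rw [← hgr, ← hb]
      exact Commute.self_pow b p
    have hord : orderOf b.right = p := by
      have := orderOf_dvd_natCard b.right
      rw [hQ] at this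
      exact ((Nat.dvd_prime hp).1 this).resolve_left (orderOf_eq_one_iff.not.2 (hg b hb))
    have hnodup : ((List.range p).map fun i => b.right ^ i).Nodup := by
      refine List.Nodup.map_on (fun i hi j hj h => ?_) List.nodup_range
      rw [List.mem_range] at hi hj
      exact pow_injOn_Iio_orderOf (by simpa [hord] using hi) (by simpa [hord] using hj) h
    have hmem : ∀ q, q ∈ (List.range p).map fun i => b.right ^ i := by
      intro q
      have hz : q ∈ Subgroup.zpowers b.right := by
        have : Subgroup.zpowers b.right = ⊤ := by
          rw [← Subgroup.card_eq_iff_eq_top, Nat.card_zpowers, hord, hQ]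
        rw [this]; trivial
      obtain ⟨i, rfl⟩ := mem_powers_iff_mem_zpowers.2 hz
      refine List.mem_map.2 ⟨i % p, List.mem_range.2 (Nat.mod_lt _ hp.pos), ?_⟩
      rw [← hord, pow_mod_orderOf]
    rw [baseHom_mul_pow hcomm, hb]
    have hprod : ((List.range p).map fun i =>
        Pi.mulSingle (M := fun _ => D) (b.right ^ i) (g.left (b.right ^ i) ^ (n - 1))).prod =
        g.left ^ (n - 1) := by
      have h := list_prod_map_mulSingle (fun q => g.left q ^ (n - 1)) _ hnodup
      rw [List.map_map] at h
      funext q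
      exact (h q).trans (if_pos (hmem q))
    rw [hprod, map_pow, ← hgr, ← pow_succ, Nat.sub_add_cancel hn]
  refine Set.ncard_le_ncard_of_injOn
    (fun a => baseHom D Q (Pi.mulSingle 1 (g.left 1 ^ (n - 1))) * a)
    (fun a ha => ⟨key a ha.1, ?_⟩) (fun a _ b _ hab => mul_left_cancel hab) (Set.toFinite _)
  rw [mul_assoc]
  exact key _ ha.2

/-! ### Reduction to `p`-power exponents -/

theorem ncard_powerSet_one_le {G : Type*} [Group G] [Finite G] (u g : G) {n : ℕ} (hn : 0 < n) :
    (powerSet 1 u g).ncard ≤ (powerSet 1 u (g ^ n)).ncard := by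
  refine Set.ncard_le_ncard_of_injOn (fun a => g ^ (n - 1) * a) (fun a ha => ?_)
    (fun a _ b _ hab => mul_left_cancel hab) (Set.toFinite _)
  obtain ⟨h1, h2⟩ := ha
  rw [pow_one] at h1 h2
  refine ⟨?_, ?_⟩
  · rw [pow_one, h1, ← pow_succ, Nat.sub_add_cancel hn]
  · rw [pow_one, mul_assoc, h2, ← pow_succ, Nat.sub_add_cancel hn]

theorem pow_pow_eq_self_of_modEq {G : Type*} [Group G] {n r : ℕ}
    (h : n * r ≡ 1 [MOD Nat.card G]) (g : G) : (g ^ n) ^ r = g := by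
  rw [← pow_mul]
  conv_rhs => rw [← pow_one g]
  exact pow_eq_pow_iff_modEq.2 (h.of_dvd (orderOf_dvd_natCard g))

theorem exists_pos_mul_modEq_one {n N : ℕ} (hn : 0 < n) (hN : 0 < N) (h : n.Coprime N) :
    ∃ r, 0 < r ∧ n * r ≡ 1 [MOD N] := by
  refine ⟨n ^ (N.totient - 1), pow_pos hn _, ?_⟩
  rw [← pow_succ', Nat.sub_add_cancel (Nat.totient_pos.2 hN)]
  exact Nat.ModEq.pow_totient h

/-- It suffices to check the `FSZ` property of a `p`-group for powers of `p`, and one inequality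
is enough. -/
theorem isFSZ_of_ncard_le {G : Type*} [Group G] [Finite G] {p : ℕ} (hp : p.Prime)
    (hG : IsPGroup p G)
    (h : ∀ (j : ℕ) (u g : G) (n : ℕ), 0 < n →
      (powerSet (p ^ j) u g).ncard ≤ (powerSet (p ^ j) u (g ^ n)).ncard) : IsFSZ G := by
  have := Fact.mk hp
  have heq : ∀ (j : ℕ) (n : ℕ), 0 < n → n.Coprime (Nat.card G) → ∀ u g : G,
      (powerSet (p ^ j) u g).ncard = (powerSet (p ^ j) u (g ^ n)).ncard := by
    intro j n hn hcop u g
    obtain ⟨r, hr, hnr⟩ := exists_pos_mul_modEq_one hn Nat.card_pos hcop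
    refine le_antisymm (h j u g n hn) ?_
    have := h j u (g ^ n) r hr
    rwa [pow_pow_eq_self_of_modEq hnr] at this
  intro m hm n hn hcop u g
  obtain ⟨j, m', hm', rfl⟩ := Nat.exists_eq_pow_mul_and_not_dvd hm.ne' p hp.ne_one
  have hcop' : m'.Coprime (Nat.card G) := by
    obtain ⟨k, hk⟩ := IsPGroup.iff_card.1 hG
    rw [hk]
    exact ((hp.coprime_iff_not_dvd.2 hm').pow_left k).symm
  obtain ⟨r, hr, hmr⟩ := exists_pos_mul_modEq_one
    (Nat.pos_of_ne_zero fun h0 => hm' (by simp [h0])) Nat.card_pos hcop'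
  -- The `m'`-th power map is a bijection of `G` with inverse the `r`-th power map.
  have hroot : ∀ a c : G, a ^ (p ^ j * m') = c ↔ a ^ p ^ j = c ^ r := by
    intro a c
    rw [pow_mul]
    constructor
    · rintro rfl
      rw [pow_pow_eq_self_of_modEq hmr]
    · intro h
      rw [h]
      exact pow_pow_eq_self_of_modEq (by rwa [mul_comm]) c
  have hset : ∀ c : G, powerSet (p ^ j * m') u c = powerSet (p ^ j) u (c ^ r) := fun c => by
    ext a
    simp only [powerSet, Set.mem_ofPred_eq, hroot]
  rw [hset, hset, heq j n hn hcop, pow_right_comm]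

/-! ### The case distinction on `g` and `j` -/

/-- If a `p`-group `D` acts by monomial matrices with entries of order `p` so that its permutation
part has exponent `p`, then the regular wreath product of `D` with a group of order `p` is
`FSZ`. -/
theorem isFSZ_wreath {C Ω : Type*} [CommGroup C] [MulAction D Ω] [Finite D] [Finite Q] [Finite Ω]
    [Nonempty Ω] {p : ℕ} (hp : p.Prime) (hC : ∀ c : C, c ^ p = 1) (M : MonomialAction C D Ω)
    (hD : IsPGroup p D) (hexp : ∀ (d : D) (x : Ω), d ^ p • x = x) (hQ : Nat.card Q = p) :
    IsFSZ (D ≀ᵣ Q) := by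
  have := Fact.mk hp
  have hG : IsPGroup p (D ≀ᵣ Q) := by
    obtain ⟨k, hk⟩ := IsPGroup.iff_card.1 hD
    refine IsPGroup.of_card (n := k * p + 1) ?_
    rw [RegularWreathProduct.card, hk, hQ, ← pow_mul, pow_succ]
  have hbase : ∀ b : D ≀ᵣ Q, b.right = 1 → ∀ x : Ω × Q, b ^ p • x = x := by
    intro b hb x
    have hb' : b = baseHom D Q b.left := by
      ext
      · rfl
      · exact hb
    rw [hb', ← map_pow]
    ext <;> simp [baseHom, hexp]
  refine isFSZ_of_ncard_le hp hG fun j u g n hn => ?_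
  by_cases hg : ∀ x : Ω × Q, g • x = x
  · exact (M.wreath Q).ncard_powerSet_le hp hC j u hg hn
  match j with
  | 0 => exact ncard_powerSet_one_le u g hn
  | 1 =>
    rw [pow_one]
    exact ncard_powerSet_le_of_right_ne_one hp hQ u (fun b hb hr => hg fun x => by rw [← hb, hbase b hr]) hn
  | j + 2 =>
    -- `a ^ p` lies in the base group, so `a ^ p ^ 2` already acts trivially and `g` would be
    -- diagonal.
    have hempty : powerSet (p ^ (j + 2)) u g = ∅ := by
      rw [Set.eq_empty_iff_forall_notMem]
      rintro a ⟨ha, -⟩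
      refine hg fun x => ?_
      have hr : (a ^ p).right = 1 := by
        rw [← pow_card_eq_one' (x := a.right), hQ]
        exact map_pow RegularWreathProduct.rightHom a p
      rw [← ha, add_comm, pow_add, pow_two, pow_mul, pow_mul]
      exact MulAction.mem_stabilizer_iff.1
        (Subgroup.pow_mem _ (MulAction.mem_stabilizer_iff.2 (hbase _ hr x)) _)
    simp [hempty]

end Wreath

/-! ### Transport to Sylow subgroups -/

theorem IsFSZ.of_mulEquiv {G H : Type*} [Group G] [Finite G] [Group H] [Finite H] (e : G ≃* H)
    (h : IsFSZ G) : IsFSZ H := by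
  have key : ∀ (m : ℕ) (u g : H),
      (powerSet m u g).ncard = (powerSet m (e.symm u) (e.symm g)).ncard := by
    intro m u g
    rw [← Set.ncard_image_of_injective _ e.symm.injective]
    congr 1
    ext a
    constructor
    · rintro ⟨b, ⟨h1, h2⟩, rfl⟩
      exact ⟨by rw [← map_pow, h1], by rw [← map_mul, ← map_pow, h2]⟩
    · rintro ⟨h1, h2⟩
      refine ⟨e a, ⟨?_, ?_⟩, by simp⟩
      · rw [← map_pow, h1, e.apply_symm_apply]
      · apply e.symm.injective
        simpa using h2
  intro m hm n hn hcop u g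
  rw [key, key, map_pow]
  exact h m hm n hn (by rwa [Nat.card_congr e.toEquiv]) _ _

/-- The regular wreath product of a trivial group with `Q` is `Q`. -/
def punitWreathEquiv (D Q : Type*) [Group D] [Unique D] [Group Q] : D ≀ᵣ Q ≃* Q where
  toFun := RegularWreathProduct.right
  invFun q := ⟨default, q⟩
  left_inv a := by
    ext
    · exact Subsingleton.elim _ _
    · rfl
  right_inv _ := rfl
  map_mul' _ _ := rfl

theorem isFSZ_wreath_wreath (p : ℕ) [Fact p.Prime] :
    IsFSZ ((Multiplicative (ZMod p) ≀ᵣ Multiplicative (ZMod p)) ≀ᵣ Multiplicative (ZMod p)) := by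
  have hp : p.Prime := Fact.out
  have hcard : Nat.card (Multiplicative (ZMod p)) = p := by simp
  have hC : ∀ c : Multiplicative (ZMod p), c ^ p = 1 := fun c =>
    orderOf_dvd_iff_pow_eq_one.1 (by simpa only [hcard] using orderOf_dvd_natCard c)
  refine isFSZ_wreath hp hC ((MonomialAction.punit _).wreath _) ?_ (fun d x => ?_) hcard
  · refine IsPGroup.of_card (n := p + 1) ?_
    rw [RegularWreathProduct.card, hcard, pow_succ]
  · have hr : (d ^ p).right = 1 :=
      (map_pow RegularWreathProduct.rightHom d p).trans (hC d.right)
    ext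
    simp [hr]

end FSZGroups

/-- `D ≀ᵣ Q` is the regular wreath product; `Multiplicative (ZMod p)` is the cyclic group of
order `p`, written multiplicatively. -/
theorem mainTheorem5 (p : ℕ) [Fact p.Prime] :
    FSZGroups.IsFSZ
      ((Multiplicative (ZMod p) ≀ᵣ Multiplicative (ZMod p)) ≀ᵣ Multiplicative (ZMod p)) ∧
    ∀ P : Sylow p (Equiv.Perm (Fin (p ^ 3))), FSZGroups.IsFSZ P := by
  refine ⟨FSZGroups.isFSZ_wreath_wreath p, fun P => ?_⟩
  let C := Multiplicative (ZMod p)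
  let e : P ≃* IteratedWreathProduct C 3 := P.mulEquivIteratedWreathProduct p 3 (Fin (p ^ 3))
    (by simp) C (by simp [C])
  have : Unique (IteratedWreathProduct C 0) := inferInstanceAs (Unique PUnit)
  let e₁ : IteratedWreathProduct C 1 ≃* C := FSZGroups.punitWreathEquiv (IteratedWreathProduct C 0) C
  let e₂ : IteratedWreathProduct C 2 ≃* C ≀ᵣ C :=
    RegularWreathProduct.congr e₁ (MulEquiv.refl C)
  let e₃ : IteratedWreathProduct C 3 ≃* (C ≀ᵣ C) ≀ᵣ C :=
    RegularWreathProduct.congr e₂ (MulEquiv.refl C)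
  exact (FSZGroups.isFSZ_wreath_wreath p).of_mulEquiv (e.trans e₃).symm
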